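/- Let $m\equiv 7\pmod 8$ be a positive integer, let $n=2^m-1$, and let $\alpha$ be a generator of $\mathbb{F}_{2^m}^*$. For $j\ge 0$ let $w_2(j)$ be the sum of the binary digits of $j$. For $S\subset\mathbb{Z}_8$ let $S'=\mathbb{Z}_8\setminus S$, let $T_S=\{1\le j\le n-1 : w_2(j)\bmod 8\in S\}$, and let $\mathcal{C}_S$ be the binary cyclic code of length $n$ with generator polynomial $g_S(x)=\prod_{i\in T_S}(x-\alpha^i)\in\mathbb{F}_2[x]$. The defining set of a binary cyclic code of length $n$ with generator polynomial $g$ is $\{i\in\mathbb{Z}_n : g(\alpha^i)=0\}$. Binary cyclic codes with defining sets $T_1,T_2$ form a pair of odd-like duadic codes if $T_1$ and $T_2$ are unions of $2$-cyclotomic cosets modulo $n$ that partition $\mathbb{Z}_n\setminus\{0\}$ and there is a unit $\mu$ of $\mathbb{Z}_n$ with $T_1\mu=T_2$ and $T_2\mu=T_1$; for such $T_1,T_2$, the cyclic codes with defining sets $\{0\}\cup T_1$ and $\{0\}\cup T_2$ form a pair of even-like duadic codes. A code has parameters $[N,k,d]$ if it has length $N$, dimension $k$ and minimum Hamming distance $d$.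 The extended code $\overline{\mathcal{C}}$ of $\mathcal{C}$ is obtained by appending an overall parity check to every codeword; a code is doubly-even if all its weights are divisible by $4$. Let $S$ be one of $\{0,1,2,3\}$, $\{0,1,3,5\}$, $\{0,1,2,4\}$, $\{0,4,5,6\}$, $\{0,2,3,6\}$, $\{0,3,5,6\}$. Then: (a) $\mathcal{C}_S$ and $\mathcal{C}_{S'}$ form a pair of odd-like duadic codes, both with parameters $[2^m-1,2^{m-1},d]$ with the same $d$. (b) The dual codes $\mathcal{C}_S^\perp$ and $\mathcal{C}_{S'}^\perp$ form a pair of even-like duadic codes, both with parameters $[2^m-1,2^{m-1}-1,d^\perp]$ with the same $d^\perp$. (c) The extended codes $\overline{\mathcal{C}_S}$ and $\overline{\mathcal{C}_{S'}}$ both have parameters $[2^m,2^{m-1},\overline d]$ with the same $\overline d\ge 2^{(m-1)/2}+4$, and they are self-dual and doubly-even. (d) The minimum distances in (a) and (b) satisfy: (1) if $S=\{0,1,2,3\}$ or $S=\{0,1,3,5\}$: $d\ge 2^{(m-1)/2}+1$ and $d^\perp\ge 2^{(m-1)/2}+2$ when $m\equiv 7\pmod{16}$; $d\ge 2^{(m-1)/2}+3$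 and $d^\perp\ge 2^{(m-1)/2}+4$ when $m\equiv 15\pmod{16}$; (2) if $S=\{0,1,2,4\}$: $d\ge 2^{(m-1)/2}+3$ and $d^\perp\ge 2^{(m-1)/2}+4$; (3) if $S=\{0,4,5,6\}$: $d\ge 2^{(m-1)/2}+1$ and $d^\perp\ge 2^{(m-1)/2}+2$; (4) if $S=\{0,2,3,6\}$ or $S=\{0,3,5,6\}$: $d\ge 2^{(m-1)/2}+3$ and $d^\perp\ge 2^{(m-1)/2}+4$ when $m\equiv 7\pmod{16}$; $d\ge 2^{(m-1)/2}+1$ and $d^\perp\ge 2^{(m-1)/2}+2$ when $m\equiv 15\pmod{16}$. -/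

import Mathlib

open Polynomial

namespace BinaryDuadic

/-- The minimum (Hamming) distance of a binary code. -/
noncomputable def minDist {ι : Type*} [Fintype ι] (C : Submodule (ZMod 2) (ι → ZMod 2)) : ℕ :=
  sInf {d : ℕ | ∃ x ∈ C, ∃ y ∈ C, x ≠ y ∧ hammingDist x y = d}

/-- `C` is a binary linear code with parameters `[n, k, d]`: length `n`, dimension `k`,
minimum distance `d`. -/
def HasParameters {ι : Type*} [Fintype ι] (C : Submodule (ZMod 2) (ι → ZMod 2))
    (n k d : ℕ) : Prop :=
  Fintype.card ι = n ∧ Module.finrank (ZMod 2) C = k ∧ minDist C = d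

/-- The dual code with respect to the standard bilinear form. -/
def dualCode {ι : Type*} [Fintype ι] (C : Submodule (ZMod 2) (ι → ZMod 2)) :
    Submodule (ZMod 2) (ι → ZMod 2) where
  carrier := {x | ∀ c ∈ C, ∑ i, x i * c i = 0}
  zero_mem' := by intro c _; simp
  add_mem' := by
    intro x y hx hy c hc
    have h1 : ∑ i, x i * c i = 0 := hx c hc
    have h2 : ∑ i, y i * c i = 0 := hy c hc
    simp [add_mul, Finset.sum_add_distrib, h1, h2]
  smul_mem' := by
    intro a x hx c hc
    have h1 : ∑ i, x i * c i = 0 := hx c hc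
    simp [mul_assoc, ← Finset.mul_sum, h1]

/-- The extended code: an overall parity check is appended to each codeword. -/
def extendedCode {n : ℕ} (C : Submodule (ZMod 2) (Fin n → ZMod 2)) :
    Submodule (ZMod 2) (Fin (n + 1) → ZMod 2) where
  carrier := {c | (fun i : Fin n => c i.castSucc) ∈ C ∧ ∑ i, c i = 0}
  zero_mem' := ⟨C.zero_mem, by simp⟩
  add_mem' := by
    rintro x y ⟨hx, hx'⟩ ⟨hy, hy'⟩
    exact ⟨C.add_mem hx hy, by simp [Finset.sum_add_distrib, hx', hy']⟩
  smul_mem' := by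
    rintro a x ⟨hx, hx'⟩
    exact ⟨C.smul_mem a hx, by simp [← Finset.mul_sum, hx']⟩

/-- A code is self-dual if it equals its dual. -/
def IsSelfDual {ι : Type*} [Fintype ι] (C : Submodule (ZMod 2) (ι → ZMod 2)) : Prop :=
  dualCode C = C

/-- A code is doubly-even if all its codewords have weight divisible by `4`. -/
def IsDoublyEven {ι : Type*} [Fintype ι] (C : Submodule (ZMod 2) (ι → ZMod 2)) : Prop :=
  ∀ c ∈ C, 4 ∣ hammingNorm c

/-- The polynomial `c₀ + c₁ x + ⋯ + c_{n-1} x^{n-1}` of a word. -/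
noncomputable def wordPoly {n : ℕ} (c : Fin n → ZMod 2) : (ZMod 2)[X] :=
  ∑ i : Fin n, C (c i) * X ^ (i : ℕ)

/-- `𝒞` is the cyclic code of length `n` with generator polynomial `g`: `g` is a monic divisor
of `x ^ n - 1` over `𝔽₂`, and the codewords are the words whose polynomial is a multiple
of `g`. -/
def IsGeneratorPolynomial {n : ℕ} (𝒞 : Submodule (ZMod 2) (Fin n → ZMod 2))
    (g : (ZMod 2)[X]) : Prop :=
  g.Monic ∧ g ∣ X ^ n - 1 ∧ ∀ c, c ∈ 𝒞 ↔ g ∣ wordPoly c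

section Extension

variable {F : Type*} [Field F] [Algebra (ZMod 2) F]

/-- `𝒞` is a cyclic code of length `n` whose defining set, relative to the `n`-th root of
unity `α`, is `T`. -/
def HasDefiningSet {n : ℕ} (α : Fˣ) (𝒞 : Submodule (ZMod 2) (Fin n → ZMod 2))
    (T : Set (ZMod n)) : Prop :=
  ∃ g : (ZMod 2)[X], IsGeneratorPolynomial 𝒞 g ∧
    T = {i : ZMod n | aeval ((α : F) ^ i.val) g = 0}

/-- The `2`-cyclotomic coset of `s` modulo `n`. -/
def cyclotomicCoset {n : ℕ} (s : ZMod n) : Set (ZMod n) :=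
  {i | ∃ t : ℕ, i = s * 2 ^ t}

/-- `(S₁, S₂, μ)` is a splitting of `ℤ_n`, for some unit `μ`, into unions of `2`-cyclotomic
cosets. -/
def IsSplitting {n : ℕ} (S₁ S₂ : Set (ZMod n)) : Prop :=
  (∀ s ∈ S₁, cyclotomicCoset s ⊆ S₁) ∧ (∀ s ∈ S₂, cyclotomicCoset s ⊆ S₂) ∧
  S₁ ∪ S₂ = {0}ᶜ ∧ S₁ ∩ S₂ = ∅ ∧
  ∃ μ : (ZMod n)ˣ, (fun i => i * (μ : ZMod n)) '' S₁ = S₂ ∧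
    (fun i => i * (μ : ZMod n)) '' S₂ = S₁

/-- `𝒞₁` and `𝒞₂` form a pair of odd-like duadic codes. -/
def IsOddLikeDuadicPair {n : ℕ} (α : Fˣ)
    (𝒞₁ 𝒞₂ : Submodule (ZMod 2) (Fin n → ZMod 2)) : Prop :=
  ∃ S₁ S₂ : Set (ZMod n), IsSplitting S₁ S₂ ∧
    HasDefiningSet α 𝒞₁ S₁ ∧ HasDefiningSet α 𝒞₂ S₂

/-- `𝒞₁` and `𝒞₂` form a pair of even-like duadic codes. -/
def IsEvenLikeDuadicPair {n : ℕ} (α : Fˣ)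
    (𝒞₁ 𝒞₂ : Submodule (ZMod 2) (Fin n → ZMod 2)) : Prop :=
  ∃ S₁ S₂ : Set (ZMod n), IsSplitting S₁ S₂ ∧
    HasDefiningSet α 𝒞₁ ({0} ∪ S₁) ∧ HasDefiningSet α 𝒞₂ ({0} ∪ S₂)

/-- The sum of the binary digits of `j`. -/
def binaryWeight (j : ℕ) : ℕ := (Nat.digits 2 j).sum

/-- `T_{[r,m,S]} = {1 ≤ j ≤ 2 ^ m - 2 : w₂(j) mod r ∈ S}`. -/
def indexSet (r m : ℕ) (S : Finset (ZMod r)) : Finset ℕ :=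
  (Finset.Icc 1 (2 ^ m - 2)).filter fun j => (binaryWeight j : ZMod r) ∈ S

/-- The polynomial `g_{[r,m,S]} = ∏_{i ∈ T_{[r,m,S]}} (x - α ^ i)`, as a polynomial over the
extension field. -/
noncomputable def genPoly (r m : ℕ) (S : Finset (ZMod r)) (α : Fˣ) : F[X] :=
  ∏ i ∈ indexSet r m S, (X - C ((α : F) ^ i))

/-- The code `𝒞_{[r,m,S]}` of length `2 ^ m - 1`: the binary words whose polynomial is a
multiple of `g_{[r,m,S]}`. -/
noncomputable def code (r m : ℕ) (S : Finset (ZMod r)) (α : Fˣ) :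
    Submodule (ZMod 2) (Fin (2 ^ m - 1) → ZMod 2) where
  carrier := {c | genPoly r m S α ∣ (wordPoly c).map (algebraMap (ZMod 2) F)}
  zero_mem' := by simp [wordPoly]
  add_mem' := by
    intro x y hx hy
    have h : wordPoly (x + y) = wordPoly x + wordPoly y := by
      simp [wordPoly, add_mul, Finset.sum_add_distrib]
    simp only [Set.mem_ofPred_eq] at *
    rw [h, Polynomial.map_add]
    exact dvd_add hx hy
  smul_mem' := by
    intro a x hx
    have h : wordPoly (a • x) = C a * wordPoly x := by
      simp [wordPoly, mul_assoc, Finset.mul_sum]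
    simp only [Set.mem_ofPred_eq] at *
    rw [h, Polynomial.map_mul]
    exact hx.mul_left _

end Extension

end BinaryDuadic

open BinaryDuadic

/-! Write `m = 2h + 1` and `n = 2^m - 1`. The exponents `j` and `n - j` have complementary binary
digits, so their weights add up to `m ≡ 7 (mod 8)`. Each listed `S` contains exactly one element of
every pair `{a, 7 - a}` (`IsReflecting`). Hence inversion of roots exchanges the zeros of the codes
of `S` and `S'`. This gives the splitting with `μ = -1`, the dimensions, and a permutation
equivalence of the two codes by reversing coordinates.

For `c` and `e` in the code with `e` of even weight, `c(x) e(1/x)` vanishes at every unit `x`.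
Therefore all cyclic correlations of `c` and `e` are zero (`sum_correlation_eq_zero`). The
correlation at shift zero identifies the dual with the even-weight subcode. All autocorrelations
together, with `n` odd, force even weights to be divisible by 4
(`four_dvd_card_of_even_differences`). The all-one word then makes the extended code doubly-even,
and its dimension makes it self-dual.

For the distance, `h` lies in `S` or in `S'`; by equivalence either code may be used. The numbers
`t(2^h - 1)` with `1 ≤ t ≤ 2^h` all have weight `h`, so the BCH bound gives weights above `2^h`
(`two_pow_lt_hammingNorm`). Divisibility by 4 raises this to `2^h + 4` in the extended code, hence
`2^h + 3` in the code and `2^h + 4` in the dual. This uniform bound covers every case of the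
theorem. -/

namespace BinaryDuadic

/-! ### Binary digit sums. -/

section BinaryWeight

theorem binaryWeight_two_mul_add (j : ℕ) {b : ℕ} (hb : b < 2) :
    binaryWeight (2 * j + b) = binaryWeight j + b := by
  unfold binaryWeight
  by_cases h : b ≠ 0 ∨ j ≠ 0
  · rw [add_comm, Nat.digits_add 2 one_lt_two b j hb h, List.sum_cons, add_comm]
  · push Not at h
    simp [h.1, h.2]

theorem binaryWeight_add_two_pow_mul (k : ℕ) {a : ℕ} (b : ℕ) (ha : a < 2 ^ k) :
    binaryWeight (a + 2 ^ k * b) = binaryWeight a + binaryWeight b := by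
  induction k generalizing a with
  | zero =>
    obtain rfl : a = 0 := by simpa using ha
    simp [binaryWeight]
  | succ k ih =>
    have h2 : a % 2 < 2 := Nat.mod_lt _ two_pos
    have ha' : a / 2 < 2 ^ k := by rw [pow_succ] at ha; omega
    have e : a + 2 ^ (k + 1) * b = 2 * (a / 2 + 2 ^ k * b) + a % 2 := by
      have := Nat.div_add_mod a 2
      rw [pow_succ, mul_add]
      linarith
    have e' : binaryWeight a = binaryWeight (a / 2) + a % 2 := by
      rw [← binaryWeight_two_mul_add _ h2, Nat.div_add_mod]
    rw [e, binaryWeight_two_mul_add _ h2, ih ha', e']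
    ring

/-- Subtraction from `2 ^ k - 1` flips each of the `k` binary digits. -/
theorem binaryWeight_compl (k : ℕ) {a : ℕ} (ha : a < 2 ^ k) :
    binaryWeight (2 ^ k - 1 - a) + binaryWeight a = k := by
  induction k generalizing a with
  | zero =>
    obtain rfl : a = 0 := by simpa using ha
    simp [binaryWeight]
  | succ k ih =>
    have ha' : a / 2 < 2 ^ k := by rw [pow_succ] at ha; omega
    have e : 2 ^ (k + 1) - 1 - a = 2 * (2 ^ k - 1 - a / 2) + (1 - a % 2) := by
      rw [pow_succ] at ha ⊢; omega
    have e' : binaryWeight a = binaryWeight (a / 2) + a % 2 := by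
      rw [← binaryWeight_two_mul_add _ (Nat.mod_lt _ two_pos), Nat.div_add_mod]
    rw [e, binaryWeight_two_mul_add _ (by omega), e']
    have := ih ha'
    omega

/-- Doubling modulo `2 ^ m - 1` rotates the `m`-digit string cyclically. This is what makes the
zeros stable under Frobenius. -/
theorem binaryWeight_two_mul_mod {m j : ℕ} (hj : j < 2 ^ m - 1) :
    binaryWeight (2 * j % (2 ^ m - 1)) = binaryWeight j := by
  rcases m with _ | m
  · simp at hj
  have hp : 0 < 2 ^ m := by positivity
  rw [pow_succ] at hj ⊢
  have hb : j / 2 ^ m < 2 := by rw [Nat.div_lt_iff_lt_mul hp]; omega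
  have ha : j % 2 ^ m < 2 ^ m := Nat.mod_lt _ hp
  have hd := Nat.mod_add_div j (2 ^ m)
  have hw : binaryWeight (j / 2 ^ m) = j / 2 ^ m := by
    simpa [binaryWeight] using binaryWeight_two_mul_add 0 hb
  have h1 : 2 * j % (2 ^ m * 2 - 1) = 2 * (j % 2 ^ m) + j / 2 ^ m := by
    have hc : j / 2 ^ m = 0 ∨ j / 2 ^ m = 1 := by omega
    rcases hc with hc | hc <;> rw [hc] at hd ⊢
    · rw [Nat.mod_eq_of_lt] <;> omega
    · rw [Nat.mod_eq_sub_mod (by omega), Nat.mod_eq_of_lt] <;> omega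
  rw [h1, binaryWeight_two_mul_add _ hb]
  conv_rhs => rw [← hd, binaryWeight_add_two_pow_mul m _ ha, hw]

/-- The upper block of digits is `t` and the lower block of `h` digits is the complement of `t`. -/
theorem binaryWeight_succ_mul_two_pow_sub_one {h t : ℕ} (ht : t < 2 ^ h) :
    binaryWeight ((t + 1) * (2 ^ h - 1)) = h := by
  have e : (t + 1) * (2 ^ h - 1) = (2 ^ h - 1 - t) + 2 ^ h * t := by
    zify [show 1 ≤ 2 ^ h from by omega, show t ≤ 2 ^ h - 1 from by omega]
    ring
  rw [e, binaryWeight_add_two_pow_mul _ _ (by omega), binaryWeight_compl _ ht]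

end BinaryWeight

/-! ### Weights, duals, equivalence and extension of binary codes. -/

section Words

variable {ι κ : Type*} [Fintype ι] [Fintype κ]

theorem finrank_dualCode (C : Submodule (ZMod 2) (ι → ZMod 2)) :
    Module.finrank (ZMod 2) (dualCode C) =
      Fintype.card ι - Module.finrank (ZMod 2) C := by
  classical
  let B : LinearMap.BilinForm (ZMod 2) (ι → ZMod 2) := Matrix.toBilin' 1
  have hB : ∀ x y, B x y = ∑ i, x i * y i := fun x y => by
    simp [B, Matrix.toBilin'_apply', dotProduct]
  have hs : B.IsSymm := ⟨fun x y => by simp [hB, mul_comm]⟩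
  have hn : B.Nondegenerate := by
    apply LinearMap.BilinForm.nondegenerate_toBilin'_of_det_ne_zero'
    simp
  have h := LinearMap.BilinForm.finrank_orthogonal hn C
  rw [Module.finrank_fintype_fun_eq_card] at h
  have hd : dualCode C = B.orthogonal C := by
    ext x
    simp only [LinearMap.BilinForm.mem_orthogonal_iff, hB]
    exact forall₂_congr fun c _ => by simp [mul_comm]
  rw [hd]
  exact h

theorem zmod_two_cases (a : ZMod 2) : a = 0 ∨ a = 1 := by
  revert a; decide

theorem sum_eq_hammingNorm (c : ι → ZMod 2) : ∑ i, c i = (hammingNorm c : ZMod 2) := by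
  rw [hammingNorm, Finset.card_filter]
  push_cast
  refine Finset.sum_congr rfl fun i _ => ?_
  rcases zmod_two_cases (c i) with h | h <;> simp [h]

theorem hammingNorm_add (x y : ι → ZMod 2) :
    hammingNorm (x + y) + 2 * hammingNorm (x * y) = hammingNorm x + hammingNorm y := by
  simp only [hammingNorm, Finset.card_filter, Finset.mul_sum, ← Finset.sum_add_distrib]
  refine Finset.sum_congr rfl fun i _ => ?_
  rcases zmod_two_cases (x i) with h | h <;> rcases zmod_two_cases (y i) with h' | h' <;>
    simp [h, h', show (1 : ZMod 2) + 1 = 0 from rfl]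

/-- The weights of `x`, `y` and `x + y` are divisible by 4, so the supports of `x` and `y` meet in
an even number of places. -/
theorem IsDoublyEven.le_dualCode {C : Submodule (ZMod 2) (ι → ZMod 2)} (h : IsDoublyEven C) :
    C ≤ dualCode C := by
  intro x hx y hy
  have h1 := hammingNorm_add x y
  have h2 := h x hx
  have h3 := h y hy
  have h4 := h _ (C.add_mem hx hy)
  have h5 : 2 ∣ hammingNorm (x * y) := by omega
  have h6 := sum_eq_hammingNorm (x * y)
  rw [(ZMod.natCast_eq_zero_iff _ _).2 h5] at h6
  exact h6

theorem IsDoublyEven.isSelfDual {C : Submodule (ZMod 2) (ι → ZMod 2)} (h : IsDoublyEven C)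
    (hd : Fintype.card ι ≤ 2 * Module.finrank (ZMod 2) C) : IsSelfDual C :=
  (Submodule.eq_of_le_of_finrank_le h.le_dualCode (by rw [finrank_dualCode]; omega)).symm

theorem minDist_eq (C : Submodule (ZMod 2) (ι → ZMod 2)) :
    minDist C = sInf {d | ∃ x ∈ C, x ≠ 0 ∧ hammingNorm x = d} := by
  unfold minDist
  congr 1
  ext d
  constructor
  · rintro ⟨x, hx, y, hy, hxy, rfl⟩
    exact ⟨-x + y, C.add_mem (C.neg_mem hx) hy, fun h => hxy (neg_add_eq_zero.1 h),
      (hammingDist_eq_hammingNorm x y).symm⟩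
  · rintro ⟨x, hx, h0, rfl⟩
    exact ⟨x, hx, 0, C.zero_mem, h0, hammingDist_zero_right x⟩

/-- The zero code is excluded because `sInf ∅ = 0`. -/
theorem le_minDist {C : Submodule (ZMod 2) (ι → ZMod 2)} {d : ℕ}
    (hC : Module.finrank (ZMod 2) C ≠ 0) (h : ∀ x ∈ C, x ≠ 0 → d ≤ hammingNorm x) :
    d ≤ minDist C := by
  rw [minDist_eq]
  refine le_csInf ?_ ?_
  · have hne : C ≠ ⊥ := by rintro rfl; simp at hC
    obtain ⟨x, hx, h0⟩ := C.exists_mem_ne_zero_of_ne_bot hne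
    exact ⟨_, x, hx, h0, rfl⟩
  · rintro _ ⟨x, hx, h0, rfl⟩
    exact h x hx h0

theorem hammingNorm_comp_equiv (σ : κ ≃ ι) (x : ι → ZMod 2) :
    hammingNorm (x ∘ σ) = hammingNorm x := by
  simp only [hammingNorm, Finset.card_filter]
  exact σ.sum_comp fun i => if x i ≠ 0 then 1 else 0

/-- `C` and `D` are permutation-equivalent through `σ`. -/
def EquivalentVia (σ : κ ≃ ι) (C : Submodule (ZMod 2) (ι → ZMod 2))
    (D : Submodule (ZMod 2) (κ → ZMod 2)) : Prop :=
  ∀ x, x ∈ C ↔ x ∘ σ ∈ D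

variable {σ : κ ≃ ι} {C : Submodule (ZMod 2) (ι → ZMod 2)} {D : Submodule (ZMod 2) (κ → ZMod 2)}

theorem EquivalentVia.minDist_eq (h : EquivalentVia σ C D) : minDist C = minDist D := by
  rw [BinaryDuadic.minDist_eq, BinaryDuadic.minDist_eq]
  congr 1
  ext d
  constructor
  · rintro ⟨x, hx, h0, rfl⟩
    refine ⟨x ∘ σ, (h x).1 hx, fun hz => h0 ?_, hammingNorm_comp_equiv σ x⟩
    rwa [← hammingNorm_eq_zero, ← hammingNorm_comp_equiv σ, hammingNorm_eq_zero]
  · rintro ⟨x, hx, h0, rfl⟩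
    have hx' : (x ∘ σ.symm) ∘ σ = x := by ext; simp
    refine ⟨x ∘ σ.symm, (h _).2 (by rwa [hx']), fun hz => h0 ?_, hammingNorm_comp_equiv _ x⟩
    rw [← hx', hz]; rfl

theorem EquivalentVia.dualCode (h : EquivalentVia σ C D) :
    EquivalentVia σ (dualCode C) (dualCode D) := by
  intro x
  constructor
  · intro hx c hc
    have hc' : (c ∘ σ.symm) ∘ σ = c := by ext; simp
    have := hx (c ∘ σ.symm) ((h _).2 (by rwa [hc']))
    rw [← σ.sum_comp] at this
    simpa using this
  · intro hx c hc
    have := hx (c ∘ σ) ((h _).1 hc)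
    rw [← σ.sum_comp]
    exact this

theorem EquivalentVia.extendedCode {n : ℕ} {σ : Equiv.Perm (Fin n)}
    {C D : Submodule (ZMod 2) (Fin n → ZMod 2)} (h : EquivalentVia σ C D) :
    EquivalentVia ((finSuccEquivLast.trans σ.optionCongr).trans finSuccEquivLast.symm)
      (extendedCode C) (extendedCode D) := by
  intro x
  refine and_congr ((h _).trans ?_) ?_
  · refine iff_of_eq (congrArg (· ∈ D) ?_)
    ext i
    simp
  · rw [← Equiv.sum_comp ((finSuccEquivLast.trans σ.optionCongr).trans finSuccEquivLast.symm)]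
    rfl

/-- Puncturing is an isomorphism from the extended code onto the code. -/
theorem finrank_extendedCode {n : ℕ} (C : Submodule (ZMod 2) (Fin n → ZMod 2)) :
    Module.finrank (ZMod 2) (extendedCode C) = Module.finrank (ZMod 2) C := by
  let f : (Fin (n + 1) → ZMod 2) →ₗ[ZMod 2] (Fin n → ZMod 2) :=
    LinearMap.funLeft (ZMod 2) (ZMod 2) Fin.castSucc
  have hm : (extendedCode C).map f = C := by
    ext c
    constructor
    · rintro ⟨x, hx, rfl⟩
      exact hx.1
    · intro hc
      refine ⟨Fin.snoc c (∑ i, c i), ⟨?_, ?_⟩, ?_⟩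
      · simpa using hc
      · rw [Fin.sum_univ_castSucc]
        simp [CharTwo.add_self_eq_zero]
      · ext i
        simp [f, LinearMap.funLeft_apply]
  have hi : Function.Injective (f.domRestrict (extendedCode C)) := by
    rw [← LinearMap.ker_eq_bot, LinearMap.ker_eq_bot']
    rintro ⟨x, hx⟩ h0
    have h1 : ∀ i : Fin n, x i.castSucc = 0 := fun i => congrFun h0 i
    have h2 := hx.2
    rw [Fin.sum_univ_castSucc] at h2
    ext i
    refine Fin.lastCases ?_ (fun i => ?_) i
    · simpa [h1] using h2
    · exact h1 i
  have h3 := LinearMap.finrank_range_of_inj hi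
  rw [LinearMap.range_domRestrict, hm] at h3
  exact h3.symm

end Words

/-! ### Difference counts in groups of odd order. -/

/-- A finite subset of an odd-order group all of whose difference counts are even has size
divisible by four. -/
theorem four_dvd_card_of_even_differences {G : Type*} [AddCommGroup G] [Fintype G] [DecidableEq G]
    (hG : Odd (Fintype.card G)) (I : Finset G)
    (hI : ∀ k : G, Even ((I ×ˢ I).filter fun p => k + p.1 = p.2).card) : 4 ∣ I.card := by
  set A : G → ℕ := fun k => ((I ×ˢ I).filter fun p => k + p.1 = p.2).card with hA
  have h0 : A 0 = I.card := by
    refine Finset.card_bij' (fun p _ => p.1) (fun i _ => (i, i)) ?_ ?_ ?_ ?_ <;>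
      simp +contextual [Prod.ext_iff]
  have hneg : ∀ k, A (-k) = A k := fun k => by
    refine Finset.card_bij' (fun p _ => p.swap) (fun p _ => p.swap) ?_ ?_ ?_ ?_
    · rintro p hp
      simp only [Finset.mem_filter, Finset.mem_product, Prod.fst_swap, Prod.snd_swap] at hp ⊢
      exact ⟨hp.1.symm, by rw [← hp.2, add_neg_cancel_left]⟩
    · rintro p hp
      simp only [Finset.mem_filter, Finset.mem_product, Prod.fst_swap, Prod.snd_swap] at hp ⊢
      exact ⟨hp.1.symm, by rw [← hp.2, neg_add_cancel_left]⟩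
    · simp
    · simp
  have hsum : ∑ k, A k = I.card * I.card := by
    rw [← Finset.card_product, Finset.card_eq_sum_card_fiberwise (f := fun p : G × G => p.2 - p.1)
      (t := Finset.univ) (by intro; simp)]
    refine Finset.sum_congr rfl fun k _ => ?_
    simp only [hA]
    congr 1
    exact Finset.filter_congr fun p _ => by rw [sub_eq_iff_eq_add, eq_comm]
  have hhalf : ∀ k, A k = 2 * (A k / 2) := fun k => (Nat.two_mul_div_two_of_even (hI k)).symm
  -- The involution `k ↦ -k` preserves `A` and, the order being odd, fixes no nonzero `k`; the terms
  -- cancel in pairs modulo 2.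
  have hcancel : ((∑ k ∈ Finset.univ.erase (0 : G), A k / 2 : ℕ) : ZMod 2) = 0 := by
    push_cast
    refine Finset.sum_involution (fun k _ => -k) ?_ ?_ ?_ ?_
    · intro k _
      rw [hneg, CharTwo.add_self_eq_zero]
    · intro k hk _ hkk
      have h2 : 2 • k = 0 := by
        rw [two_nsmul, ← sub_neg_eq_add, hkk, sub_self]
      have h3 : k = 0 := by
        have hc : Nat.Coprime 2 (addOrderOf k) :=
          (Nat.coprime_two_left.2 hG).coprime_dvd_right addOrderOf_dvd_card
        have h4 := (addOrderOf_dvd_iff_nsmul_eq_zero).2 h2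
        exact AddMonoid.addOrderOf_eq_one_iff.1 (Nat.Coprime.eq_one_of_dvd hc.symm h4)
      simp [h3] at hk
    · intro k hk; simpa using hk
    · intro k _; simp
  rw [ZMod.natCast_eq_zero_iff] at hcancel
  -- The last sum is even, so `I.card` is congruent to its square modulo 4; being even, it is then
  -- divisible by 4.
  have h5 : I.card * I.card = I.card + 2 * ∑ k ∈ Finset.univ.erase (0 : G), A k / 2 := by
    rw [← hsum, ← Finset.add_sum_erase _ _ (Finset.mem_univ (0 : G)), h0, Finset.mul_sum]
    exact congrArg _ (Finset.sum_congr rfl fun k _ => hhalf k)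
  have h6 : Even I.card := h0 ▸ hI 0
  obtain ⟨a, ha⟩ := h6
  obtain ⟨b, hb⟩ := hcancel
  rw [hb, ha] at h5
  have h8 : (a + a) * (a + a) = 4 * (a * a) := by ring
  omega

/-! ### Word polynomials and the dimension of a cyclic code. -/

section WordPoly

variable {n : ℕ}

theorem wordPoly_add (c e : Fin n → ZMod 2) : wordPoly (c + e) = wordPoly c + wordPoly e := by
  simp [wordPoly, add_mul, Finset.sum_add_distrib]

theorem wordPoly_smul (a : ZMod 2) (c : Fin n → ZMod 2) :
    wordPoly (a • c) = C a * wordPoly c := by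
  simp [wordPoly, mul_assoc, Finset.mul_sum]

theorem coeff_wordPoly (c : Fin n → ZMod 2) (i : Fin n) : (wordPoly c).coeff i = c i := by
  simp [wordPoly, coeff_X_pow, Fin.val_inj]

theorem degree_wordPoly_lt (c : Fin n → ZMod 2) : (wordPoly c).degree < n := by
  refine (degree_sum_le _ _).trans_lt ((Finset.sup_lt_iff (WithBot.bot_lt_coe n)).2 fun i _ => ?_)
  exact (degree_C_mul_X_pow_le _ _).trans_lt (WithBot.coe_lt_coe.2 i.2)

theorem wordPoly_coeff {q : (ZMod 2)[X]} (hq : q.degree < n) :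
    wordPoly (fun i : Fin n => q.coeff i) = q := by
  ext k
  by_cases hk : k < n
  · exact coeff_wordPoly (fun i : Fin n => q.coeff i) ⟨k, hk⟩
  · have hk' : (n : WithBot ℕ) ≤ k := by exact_mod_cast not_lt.1 hk
    rw [coeff_eq_zero_of_degree_lt (hq.trans_le hk'),
      coeff_eq_zero_of_degree_lt ((degree_wordPoly_lt _).trans_le hk')]

theorem aeval_wordPoly {F : Type*} [Field F] [Algebra (ZMod 2) F] (c : Fin n → ZMod 2) (x : F) :
    aeval x (wordPoly c) = ∑ i, algebraMap (ZMod 2) F (c i) * x ^ (i : ℕ) := by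
  simp [wordPoly, aeval_C]

/-- The words whose polynomials are multiples of `g`. -/
noncomputable def cyclicCode (n : ℕ) (g : (ZMod 2)[X]) : Submodule (ZMod 2) (Fin n → ZMod 2) where
  carrier := {c | g ∣ wordPoly c}
  zero_mem' := by simp [wordPoly]
  add_mem' := fun {x y} hx hy => by
    simp only [Set.mem_ofPred_eq] at *
    rw [wordPoly_add]
    exact dvd_add hx hy
  smul_mem' := fun a x hx => by
    simp only [Set.mem_ofPred_eq] at *
    rw [wordPoly_smul]
    exact hx.mul_left _

/-- Multiplication by `g` maps the polynomials of degree below `n - g.natDegree` isomorphically onto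
the code. -/
theorem IsGeneratorPolynomial.finrank_eq {𝒞 : Submodule (ZMod 2) (Fin n → ZMod 2)}
    {g : (ZMod 2)[X]} (hn : n ≠ 0) (h : IsGeneratorPolynomial 𝒞 g) :
    Module.finrank (ZMod 2) 𝒞 = n - g.natDegree := by
  obtain ⟨hg, hdvd, hmem⟩ := h
  have hle : g.natDegree ≤ n := by
    have := natDegree_le_of_dvd hdvd (X_pow_sub_C_ne_zero (Nat.pos_of_ne_zero hn) 1)
    rwa [← C_1, natDegree_X_pow_sub_C] at this
  let φ : degreeLT (ZMod 2) (n - g.natDegree) →ₗ[ZMod 2] (Fin n → ZMod 2) :=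
    (LinearMap.pi fun i : Fin n => lcoeff (ZMod 2) i) ∘ₗ
      (LinearMap.mulLeft (ZMod 2) g) ∘ₗ Submodule.subtype _
  have hdeg : ∀ p : degreeLT (ZMod 2) (n - g.natDegree), (g * p.1).degree < n := by
    rintro ⟨p, hp⟩
    rw [mem_degreeLT] at hp
    by_cases hp0 : p = 0
    · simp [hp0]
    · rw [degree_eq_natDegree hp0] at hp
      rw [degree_eq_natDegree (mul_ne_zero hg.ne_zero hp0), natDegree_mul hg.ne_zero hp0]
      norm_cast at hp ⊢
      omega
  have hφ : ∀ p, wordPoly (φ p) = g * p.1 := fun p => wordPoly_coeff (hdeg p)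
  have hinj : Function.Injective φ := by
    rw [← LinearMap.ker_eq_bot, LinearMap.ker_eq_bot']
    intro p hp
    have h1 := hφ p
    rw [hp] at h1
    have h2 : g * p.1 = 0 := by rw [← h1]; simp [wordPoly]
    exact Subtype.ext ((mul_eq_zero.1 h2).resolve_left hg.ne_zero)
  have hrange : LinearMap.range φ = 𝒞 := by
    ext c
    rw [hmem]
    constructor
    · rintro ⟨p, rfl⟩
      exact ⟨p.1, hφ p⟩
    · rintro ⟨q, hq⟩
      have hq' : q ∈ degreeLT (ZMod 2) (n - g.natDegree) := by
        rw [mem_degreeLT]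
        by_cases hq0 : q = 0
        · simp [hq0]
        · have h1 := degree_wordPoly_lt c
          rw [hq, degree_eq_natDegree (mul_ne_zero hg.ne_zero hq0),
            natDegree_mul hg.ne_zero hq0] at h1
          rw [degree_eq_natDegree hq0]
          norm_cast at h1 ⊢
          omega
      refine ⟨⟨q, hq'⟩, funext fun i => ?_⟩
      rw [← coeff_wordPoly c i, hq]
      rfl
  have h1 := LinearMap.finrank_range_of_inj hinj
  rw [hrange, (degreeLTEquiv (ZMod 2) _).finrank_eq, Module.finrank_fin_fun] at h1
  exact h1

end WordPoly

/-! ### The BCH bound and cyclic correlations. -/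

section Field

variable {F : Type*} [Field F] [Algebra (ZMod 2) F]

/-- The BCH bound for a run of `δ` zeros `β, β ^ 2, …, β ^ δ`. -/
theorem lt_hammingNorm_of_consecutive_zeros {n : ℕ} {β : F} (h0 : β ≠ 0)
    (hβ : Set.InjOn (fun i : ℕ => β ^ i) (Set.Iio n)) {c : Fin n → ZMod 2} (hc : c ≠ 0) {δ : ℕ}
    (hz : ∀ t < δ, aeval (β ^ (t + 1)) (wordPoly c) = 0) : δ < hammingNorm c := by
  by_contra! hle
  obtain ⟨i₀, hi₀⟩ := Function.ne_iff.1 hc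
  set I : Finset (Fin n) := Finset.univ.filter fun i => c i ≠ 0 with hI
  have hmem : i₀ ∈ I := by simpa [hI] using hi₀
  have hcard : I.card ≤ δ := hle
  -- `P` vanishes at every support point except `i₀`. Since its degree is below `δ`, the sum of `c i
  -- * β ^ i * P(β ^ i)` is a combination of the `δ` vanishing values, although only its term at
  -- `i₀` survives and is nonzero.
  set P : F[X] := ∏ i ∈ I.erase i₀, (X - C (β ^ (i : ℕ))) with hP
  have hdeg : P.natDegree < δ := by
    rw [hP, natDegree_prod_of_monic _ _ fun i _ => monic_X_sub_C _]
    simp only [natDegree_X_sub_C, Finset.sum_const, smul_eq_mul, mul_one]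
    exact (Finset.card_erase_lt_of_mem hmem).trans_le hcard
  have h1 : ∑ i, algebraMap (ZMod 2) F (c i) * β ^ (i : ℕ) * P.eval (β ^ (i : ℕ)) = 0 := by
    simp_rw [eval_eq_sum_range' hdeg, Finset.mul_sum]
    rw [Finset.sum_comm]
    refine Finset.sum_eq_zero fun t ht => ?_
    have h2 := hz t (Finset.mem_range.1 ht)
    rw [aeval_wordPoly] at h2
    rw [← mul_zero (P.coeff t), ← h2, Finset.mul_sum]
    exact Finset.sum_congr rfl fun i _ => by ring
  rw [Finset.sum_eq_single i₀] at h1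
  · rcases mul_eq_zero.1 h1 with h2 | h2
    · rcases mul_eq_zero.1 h2 with h3 | h3
      · exact hi₀ ((map_eq_zero _).1 h3)
      · exact pow_ne_zero _ h0 h3
    · rw [hP, eval_prod, Finset.prod_eq_zero_iff] at h2
      obtain ⟨i, hi, h3⟩ := h2
      rw [eval_sub, eval_X, eval_C, sub_eq_zero] at h3
      exact Finset.ne_of_mem_erase hi (Fin.ext (hβ i.2 i₀.2 h3.symm))
  · intro i _ hne
    by_cases hi : c i = 0
    · simp [hi]
    · have : P.eval (β ^ (i : ℕ)) = 0 := by
        rw [hP, eval_prod]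
        exact Finset.prod_eq_zero (Finset.mem_erase.2 ⟨hne, by simpa [hI] using hi⟩) (by simp)
      rw [this, mul_zero]
  · simp

theorem aeval_wordPoly_comp_rev {n : ℕ} (c : Fin n → ZMod 2) (x : Fˣ) :
    aeval (x : F) (wordPoly (c ∘ Fin.revPerm)) =
      (x : F) ^ (n - 1) * aeval ((x⁻¹ : Fˣ) : F) (wordPoly c) := by
  rw [aeval_wordPoly, aeval_wordPoly, ← Equiv.sum_comp Fin.revPerm, Finset.mul_sum]
  refine Finset.sum_congr rfl fun i _ => ?_
  have h : (x : F) ^ (n - 1) = (x : F) ^ (i.rev : ℕ) * (x : F) ^ (i : ℕ) := by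
    rw [← pow_add, Fin.val_rev]
    congr 1
    omega
  have h2 : (x : F) ^ (i : ℕ) * ((x⁻¹ : Fˣ) : F) ^ (i : ℕ) = 1 := by
    rw [← mul_pow, Units.mul_inv, one_pow]
  simp only [Function.comp_apply, Fin.revPerm_apply, Fin.rev_rev]
  rw [h, mul_left_comm, mul_assoc, h2, mul_one]

/-- Fourier inversion on the cyclic group `Fˣ`: modulo `x ^ n - 1` the correlations are the
coefficients of `c(x) e(1/x)`. Multiplying by `x ^ k` and summing over the units extracts one of
them up to sign, since a power sum over `Fˣ` is `-1` if `n` divides the exponent and `0` otherwise.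
-/
theorem sum_correlation_eq_zero [Finite F] {n : ℕ} [NeZero n] (hn : Nat.card Fˣ = n)
    {c e : Fin n → ZMod 2}
    (h : ∀ x : Fˣ, aeval (x : F) (wordPoly c) * aeval ((x⁻¹ : Fˣ) : F) (wordPoly e) = 0)
    (k : ZMod n) :
    ∑ i : Fin n, ∑ j : Fin n,
      (if k + ((i : ℕ) : ZMod n) = ((j : ℕ) : ZMod n) then c i * e j else 0) = 0 := by
  classical
  have := Fintype.ofFinite F
  have hn' : Fintype.card F - 1 = n := by rw [← Fintype.card_units, ← Nat.card_eq_fintype_card, hn]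
  have hx : ∀ x : Fˣ, (x : F) ^ k.val *
      (aeval (x : F) (wordPoly c) * aeval ((x⁻¹ : Fˣ) : F) (wordPoly e)) =
      ∑ i : Fin n, ∑ j : Fin n, algebraMap (ZMod 2) F (c i * e j) *
        (x : F) ^ (k.val + i + (n - j)) := by
    intro x
    rw [aeval_wordPoly, aeval_wordPoly, Finset.sum_mul_sum, Finset.mul_sum]
    refine Finset.sum_congr rfl fun i _ => ?_
    rw [Finset.mul_sum]
    refine Finset.sum_congr rfl fun j _ => ?_
    have hj : ((x⁻¹ : Fˣ) : F) ^ (j : ℕ) = (x : F) ^ (n - (j : ℕ)) := by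
      have h1 : x ^ n = 1 := by rw [← hn]; exact pow_card_eq_one'
      rw [← Units.val_pow_eq_pow_val, ← Units.val_pow_eq_pow_val, inv_pow]
      congr 1
      rw [inv_eq_iff_mul_eq_one, ← pow_add, Nat.add_sub_cancel' j.2.le, h1]
    rw [hj, map_mul, pow_add, pow_add]
    ring
  have h0 : ∑ x : Fˣ, ∑ i : Fin n, ∑ j : Fin n, algebraMap (ZMod 2) F (c i * e j) *
        (x : F) ^ (k.val + i + (n - j)) = 0 :=
    Finset.sum_eq_zero fun x _ => by rw [← hx, h, mul_zero]
  rw [Finset.sum_comm] at h0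
  apply (algebraMap (ZMod 2) F).injective
  rw [map_zero, ← neg_eq_zero, ← h0, map_sum, ← Finset.sum_neg_distrib]
  refine Finset.sum_congr rfl fun i _ => ?_
  rw [Finset.sum_comm, map_sum, ← Finset.sum_neg_distrib]
  refine Finset.sum_congr rfl fun j _ => ?_
  rw [← Finset.mul_sum, FiniteField.sum_pow_units, hn']
  have hiff : n ∣ k.val + i + (n - j) ↔ k + ((i : ℕ) : ZMod n) = ((j : ℕ) : ZMod n) := by
    rw [← ZMod.natCast_eq_zero_iff]
    push_cast [j.2.le]
    rw [ZMod.natCast_self, ZMod.natCast_zmod_val, zero_sub, ← sub_eq_add_neg, sub_eq_zero]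
  simp only [hiff]
  split_ifs <;> simp

theorem sum_mul_eq_zero_of_aeval [Finite F] {n : ℕ} [NeZero n] (hn : Nat.card Fˣ = n)
    {c e : Fin n → ZMod 2}
    (h : ∀ x : Fˣ, aeval (x : F) (wordPoly c) * aeval ((x⁻¹ : Fˣ) : F) (wordPoly e) = 0) :
    ∑ i, c i * e i = 0 := by
  rw [← sum_correlation_eq_zero hn h 0]
  refine Finset.sum_congr rfl fun i _ => ?_
  rw [Finset.sum_eq_single i]
  · simp
  · intro j _ hne
    rw [if_neg]
    rw [zero_add]
    intro hij
    rw [ZMod.natCast_eq_natCast_iff', Nat.mod_eq_of_lt i.2, Nat.mod_eq_of_lt j.2] at hij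
    exact hne (Fin.ext hij.symm)
  · simp

/-- The autocorrelations of `c` are the difference counts of its support modulo 2. -/
theorem four_dvd_hammingNorm_of_aeval [Finite F] {n : ℕ} [NeZero n] (hn : Nat.card Fˣ = n)
    (hodd : Odd n) {c : Fin n → ZMod 2}
    (h : ∀ x : Fˣ, aeval (x : F) (wordPoly c) * aeval ((x⁻¹ : Fˣ) : F) (wordPoly c) = 0) :
    4 ∣ hammingNorm c := by
  classical
  have hinj : Function.Injective fun i : Fin n => ((i : ℕ) : ZMod n) := fun i j hij => by
    simp only [ZMod.natCast_eq_natCast_iff', Nat.mod_eq_of_lt i.2, Nat.mod_eq_of_lt j.2] at hij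
    exact Fin.ext hij
  have hcard : hammingNorm c =
      ((Finset.univ.filter fun i => c i ≠ 0).image fun i : Fin n => ((i : ℕ) : ZMod n)).card :=
    (Finset.card_image_of_injective _ hinj).symm
  rw [hcard]
  refine four_dvd_card_of_even_differences (by rwa [ZMod.card]) _ fun k => ?_
  rw [← ZMod.natCast_eq_zero_iff_even]
  refine Eq.trans ?_ (sum_correlation_eq_zero hn h k)
  rw [Finset.card_filter, Finset.sum_product, Finset.sum_image hinj.injOn, Finset.sum_filter]
  push_cast
  refine Finset.sum_congr rfl fun i _ => ?_
  rcases zmod_two_cases (c i) with hi | hi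
  · simp [hi]
  · rw [if_pos (by simp [hi]), Finset.sum_image hinj.injOn, Finset.sum_filter]
    refine Finset.sum_congr rfl fun j _ => ?_
    rcases zmod_two_cases (c j) with hj | hj <;> simp [hi, hj]

end Field

/-! ### Zeros of the generator polynomial and the splitting by `-1`. -/

section RootSet

variable {F : Type*} [Field F] {r m : ℕ} {S : Finset (ZMod r)} {α : Fˣ}

theorem mem_indexSet {j : ℕ} :
    j ∈ indexSet r m S ↔ (1 ≤ j ∧ j ≤ 2 ^ m - 2) ∧ (binaryWeight j : ZMod r) ∈ S := by
  simp [indexSet]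

/-- The zeros of the generator polynomial `genPoly r m S α`. -/
def rootSet (r m : ℕ) (S : Finset (ZMod r)) (α : Fˣ) : Set Fˣ :=
  {x | ∃ j ∈ indexSet r m S, α ^ j = x}

theorem pow_inj_of_orderOf {n : ℕ} (hα : orderOf α = n) {i j : ℕ} (hi : i < n)
    (hj : j < n) (h : α ^ i = α ^ j) : i = j :=
  pow_injOn_Iio_orderOf (by simpa [hα] using hi) (by simpa [hα] using hj) h

theorem pow_mem_rootSet (hα : orderOf α = 2 ^ m - 1) {j : ℕ} (hj : j < 2 ^ m - 1) :
    α ^ j ∈ rootSet r m S α ↔ j ≠ 0 ∧ (binaryWeight j : ZMod r) ∈ S := by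
  constructor
  · rintro ⟨i, hi, h⟩
    rw [mem_indexSet] at hi
    obtain rfl : i = j := pow_inj_of_orderOf hα (by omega) hj h
    exact ⟨by omega, hi.2⟩
  · rintro ⟨h0, hw⟩
    exact ⟨j, mem_indexSet.2 ⟨⟨by omega, by omega⟩, hw⟩, rfl⟩

theorem one_notMem_rootSet (hα : orderOf α = 2 ^ m - 1) : (1 : Fˣ) ∉ rootSet r m S α := by
  rintro ⟨j, hj, h⟩
  rw [mem_indexSet] at hj
  have := pow_inj_of_orderOf hα (by omega) (by omega : 0 < 2 ^ m - 1) (h.trans (pow_zero α).symm)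
  omega

theorem exists_pow_eq [Finite F] (hgen : Subgroup.zpowers α = ⊤) {n : ℕ} (hα : orderOf α = n)
    (x : Fˣ) : ∃ j < n, α ^ j = x := by
  classical
  have h : x ∈ Subgroup.zpowers α := hgen ▸ Subgroup.mem_top x
  rw [mem_zpowers_iff_mem_range_orderOf, Finset.mem_image] at h
  obtain ⟨j, hj, h⟩ := h
  exact ⟨j, hα ▸ Finset.mem_range.1 hj, h⟩

theorem sq_mem_rootSet (hα : orderOf α = 2 ^ m - 1) {x : Fˣ} (hx : x ∈ rootSet r m S α) :
    x ^ 2 ∈ rootSet r m S α := by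
  obtain ⟨j, hj, rfl⟩ := hx
  rw [mem_indexSet] at hj
  have hlt : j < 2 ^ m - 1 := by omega
  have h1 : (α ^ j) ^ 2 = α ^ (2 * j % (2 ^ m - 1)) := by
    rw [← hα, pow_mod_orderOf, ← pow_mul, mul_comm]
  rw [h1, pow_mem_rootSet hα (Nat.mod_lt _ (by omega)), binaryWeight_two_mul_mod hlt]
  refine ⟨fun h0 => ?_, hj.2⟩
  have hodd : Nat.Coprime (2 ^ m - 1) 2 := by
    rcases m with _ | m
    · simp at hlt
    · rw [Nat.coprime_two_right, pow_succ]
      exact ⟨2 ^ m - 1, by omega⟩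
  have h2 := hodd.dvd_of_dvd_mul_left (Nat.dvd_of_mod_eq_zero h0)
  have := Nat.le_of_dvd (by omega) h2
  omega

/-- Of two elements of `ℤ/r` whose sum is `m`, exactly one lies in `S`. -/
def IsReflecting (m : ℕ) (S : Finset (ZMod r)) : Prop :=
  ∀ a : ZMod r, (m : ZMod r) - a ∈ S ↔ a ∉ S

theorem IsReflecting.compl [NeZero r] (hS : IsReflecting m S) : IsReflecting m Sᶜ := fun a => by
  rw [Finset.mem_compl, Finset.mem_compl, not_iff_not]
  exact hS a

theorem IsReflecting.binaryWeight_sub_mem (hS : IsReflecting m S) {j : ℕ} (hj : j < 2 ^ m) :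
    (binaryWeight (2 ^ m - 1 - j) : ZMod r) ∈ S ↔ (binaryWeight j : ZMod r) ∉ S := by
  rw [← hS]
  have h := binaryWeight_compl m hj
  have h' : (m : ZMod r) - binaryWeight j = binaryWeight (2 ^ m - 1 - j) := by
    rw [sub_eq_iff_eq_add, ← Nat.cast_add, h]
  rw [h']

/-- Inversion replaces the exponent `j` by its digit complement. The unit `1` is exceptional: it
belongs to no root set. -/
theorem inv_mem_rootSet [Finite F] (hgen : Subgroup.zpowers α = ⊤) (hα : orderOf α = 2 ^ m - 1)
    (hS : IsReflecting m S) {x : Fˣ} (hx : x ≠ 1) :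
    x⁻¹ ∈ rootSet r m S α ↔ x ∉ rootSet r m S α := by
  obtain ⟨j, hj, rfl⟩ := exists_pow_eq hgen hα x
  have h0 : j ≠ 0 := by rintro rfl; simp at hx
  have hinv : (α ^ j)⁻¹ = α ^ (2 ^ m - 1 - j) := by
    rw [inv_eq_iff_mul_eq_one, ← pow_add, Nat.add_sub_cancel' hj.le, ← hα, pow_orderOf_eq_one]
  rw [hinv, pow_mem_rootSet hα (by omega), pow_mem_rootSet hα hj,
    hS.binaryWeight_sub_mem (by omega)]
  simp only [h0, ne_eq, not_false_eq_true, true_and, and_iff_right_iff_imp]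
  omega

theorem mem_rootSet_compl [NeZero r] [Finite F] (hgen : Subgroup.zpowers α = ⊤)
    (hα : orderOf α = 2 ^ m - 1) {x : Fˣ} :
    x ∈ rootSet r m Sᶜ α ↔ x ≠ 1 ∧ x ∉ rootSet r m S α := by
  obtain ⟨j, hj, rfl⟩ := exists_pow_eq hgen hα x
  rw [pow_mem_rootSet hα hj, pow_mem_rootSet hα hj, Finset.mem_compl]
  have h1 : α ^ j = 1 ↔ j = 0 :=
    ⟨fun h => pow_inj_of_orderOf hα hj (by omega) (by rw [h, pow_zero]), fun h => by simp [h]⟩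
  simp only [ne_eq, h1]
  tauto

theorem inv_mem_rootSet_compl [NeZero r] [Finite F] (hgen : Subgroup.zpowers α = ⊤)
    (hα : orderOf α = 2 ^ m - 1) (hS : IsReflecting m S) (x : Fˣ) :
    x⁻¹ ∈ rootSet r m Sᶜ α ↔ x ∈ rootSet r m S α := by
  rw [mem_rootSet_compl hgen hα]
  by_cases hx : x = 1
  · subst hx
    simp [one_notMem_rootSet hα]
  · rw [inv_mem_rootSet hgen hα hS hx]
    simp [hx]

/-- Digit complement matches the exponents selected by `S` with the others, so exactly half of the
`2 ^ m - 2` exponents are selected. -/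
theorem IsReflecting.card_indexSet (hm : m ≠ 0) (hS : IsReflecting m S) :
    (indexSet r m S).card = 2 ^ (m - 1) - 1 := by
  obtain ⟨k, rfl⟩ := Nat.exists_eq_succ_of_ne_zero hm
  have hp : 0 < 2 ^ k := by positivity
  have hpow : 2 ^ (k + 1) = 2 * 2 ^ k := by ring
  have h1 := Finset.card_filter_add_card_filter_not (s := Finset.Icc 1 (2 ^ (k + 1) - 2))
    (fun j => (binaryWeight j : ZMod r) ∈ S)
  have h2 : ((Finset.Icc 1 (2 ^ (k + 1) - 2)).filter
      fun j => ¬ (binaryWeight j : ZMod r) ∈ S).card = (indexSet r (k + 1) S).card := by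
    refine Finset.card_bij' (fun j _ => 2 ^ (k + 1) - 1 - j) (fun j _ => 2 ^ (k + 1) - 1 - j)
      ?_ ?_ ?_ ?_
    · intro j hj
      rw [Finset.mem_filter, Finset.mem_Icc] at hj
      exact mem_indexSet.2 ⟨by omega, (hS.binaryWeight_sub_mem (by omega)).2 hj.2⟩
    · intro j hj
      rw [mem_indexSet] at hj
      rw [Finset.mem_filter, Finset.mem_Icc]
      refine ⟨by omega, ?_⟩
      rw [hS.binaryWeight_sub_mem (by omega)]
      exact not_not.2 hj.2
    · intro j hj
      rw [Finset.mem_filter, Finset.mem_Icc] at hj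
      exact Nat.sub_sub_self (by omega)
    · intro j hj
      rw [mem_indexSet] at hj
      exact Nat.sub_sub_self (by omega)
  rw [h2, Nat.card_Icc, show (Finset.Icc 1 (2 ^ (k + 1) - 2)).filter
    (fun j => (binaryWeight j : ZMod r) ∈ S) = indexSet r (k + 1) S from rfl] at h1
  simp only [Nat.succ_eq_add_one, Nat.add_sub_cancel]
  omega

theorem monic_genPoly : (genPoly r m S α).Monic :=
  monic_prod_of_monic _ _ fun _ _ => monic_X_sub_C _

theorem natDegree_genPoly : (genPoly r m S α).natDegree = (indexSet r m S).card := by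
  rw [genPoly, natDegree_prod_of_monic _ _ fun _ _ => monic_X_sub_C _]
  rw [Finset.card_eq_sum_ones]
  exact Finset.sum_congr rfl fun _ _ => natDegree_X_sub_C _

theorem genPoly_dvd_iff (hα : orderOf α = 2 ^ m - 1) {p : F[X]} :
    genPoly r m S α ∣ p ↔ ∀ x ∈ rootSet r m S α, p.eval (x : F) = 0 := by
  constructor
  · rintro ⟨q, rfl⟩ _ ⟨j, hj, rfl⟩
    rw [eval_mul, genPoly, eval_prod, Finset.prod_eq_zero hj (by simp), zero_mul]
  · intro h
    refine Finset.prod_dvd_of_coprime ?_ fun j hj => ?_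
    · intro i hi j hj hij
      rw [Finset.mem_coe, mem_indexSet] at hi hj
      refine pairwise_coprime_X_sub_C Function.injective_id fun h => hij ?_
      exact pow_inj_of_orderOf hα (by omega) (by omega) (Units.ext (by simpa using h))
    · rw [dvd_iff_isRoot]
      simpa using h _ ⟨j, hj, rfl⟩

theorem odd_two_pow_sub_one (hm : m ≠ 0) : Odd (2 ^ m - 1) := by
  obtain ⟨k, rfl⟩ := Nat.exists_eq_succ_of_ne_zero hm
  have : 0 < 2 ^ k := by positivity
  exact ⟨2 ^ k - 1, by rw [Nat.succ_eq_add_one, pow_succ]; omega⟩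

theorem card_units_of_generator (hgen : Subgroup.zpowers α = ⊤) (hα : orderOf α = 2 ^ m - 1) :
    Nat.card Fˣ = 2 ^ m - 1 := by
  rw [← hα, orderOf_eq_card_of_zpowers_eq_top hgen]

theorem isSplitting_rootSet [NeZero r] [Finite F] (hgen : Subgroup.zpowers α = ⊤)
    (hα : orderOf α = 2 ^ m - 1) (hm : m ≠ 0) (hS : IsReflecting m S) :
    IsSplitting {i : ZMod (2 ^ m - 1) | α ^ i.val ∈ rootSet r m S α}
      {i : ZMod (2 ^ m - 1) | α ^ i.val ∈ rootSet r m Sᶜ α} := by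
  have : NeZero (2 ^ m - 1) := ⟨(odd_two_pow_sub_one hm).pos.ne'⟩
  have hpow : ∀ k, α ^ (k % (2 ^ m - 1)) = α ^ k := fun k => by rw [← hα, pow_mod_orderOf]
  have hadd : ∀ i j : ZMod (2 ^ m - 1), α ^ (i + j).val = α ^ i.val * α ^ j.val := fun i j => by
    rw [ZMod.val_add, hpow, pow_add]
  have hcoset : ∀ {U : Finset (ZMod r)} (s : ZMod (2 ^ m - 1)), α ^ s.val ∈ rootSet r m U α →
      ∀ t : ℕ, α ^ (s * 2 ^ t).val ∈ rootSet r m U α := by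
    intro U s hs t
    induction t with
    | zero => simpa using hs
    | succ t ih =>
      rw [pow_succ, ← mul_assoc, mul_two, hadd, ← sq]
      exact sq_mem_rootSet hα ih
  have hneg : ∀ i : ZMod (2 ^ m - 1), α ^ (-i).val = (α ^ i.val)⁻¹ := fun i => by
    rw [eq_inv_iff_mul_eq_one, ← hadd, neg_add_cancel, ZMod.val_zero, pow_zero]
  have hone : ∀ i : ZMod (2 ^ m - 1), α ^ i.val = 1 ↔ i = 0 := fun i => by
    rw [← ZMod.val_eq_zero]
    exact ⟨fun h => pow_inj_of_orderOf hα i.val_lt (NeZero.pos _) (by rw [h, pow_zero]),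
      fun h => by rw [h, pow_zero]⟩
  have hflip : ∀ i : ZMod (2 ^ m - 1),
      α ^ (-i).val ∈ rootSet r m Sᶜ α ↔ α ^ i.val ∈ rootSet r m S α := fun i => by
    rw [hneg, inv_mem_rootSet_compl hgen hα hS]
  refine ⟨?_, ?_, ?_, ?_, -1, ?_, ?_⟩
  · rintro s hs _ ⟨t, rfl⟩
    exact hcoset s hs t
  · rintro s hs _ ⟨t, rfl⟩
    exact hcoset s hs t
  · ext i
    simp only [Set.mem_union, Set.mem_ofPred_eq, Set.mem_compl_iff, Set.mem_singleton_iff]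
    rw [mem_rootSet_compl hgen hα, ne_eq, hone]
    by_cases h0 : i = 0
    · subst h0
      simp [one_notMem_rootSet hα]
    · tauto
  · ext i
    simp only [Set.mem_inter_iff, Set.mem_ofPred_eq, Set.mem_empty_iff_false, iff_false]
    rw [mem_rootSet_compl hgen hα]
    tauto
  · ext i
    simp only [Units.val_neg, Units.val_one, mul_neg, mul_one, Set.mem_image, Set.mem_ofPred_eq]
    constructor
    · rintro ⟨j, hj, rfl⟩
      exact (hflip j).2 hj
    · intro hi
      exact ⟨-i, (hflip (-i)).1 (by rwa [neg_neg]), neg_neg i⟩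
  · ext i
    simp only [Units.val_neg, Units.val_one, mul_neg, mul_one, Set.mem_image, Set.mem_ofPred_eq]
    constructor
    · rintro ⟨j, hj, rfl⟩
      exact (hflip (-j)).1 (by rwa [neg_neg])
    · intro hi
      exact ⟨-i, (hflip i).2 hi, neg_neg i⟩

end RootSet

/-! ### Descent of the generator polynomial to the prime field. -/

section Code

variable {F : Type*} [Field F] [Algebra (ZMod 2) F] {r m : ℕ} {S : Finset (ZMod r)} {α : Fˣ}

theorem mem_code_iff (hα : orderOf α = 2 ^ m - 1) {c : Fin (2 ^ m - 1) → ZMod 2} :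
    c ∈ code r m S α ↔ ∀ x ∈ rootSet r m S α, aeval (x : F) (wordPoly c) = 0 :=
  (genPoly_dvd_iff hα).trans (by simp [aeval_def, eval_map])

/-- The generator polynomial is stable under the Frobenius, hence has coefficients in `𝔽₂`. -/
theorem exists_map_eq_genPoly (hα : orderOf α = 2 ^ m - 1) :
    ∃ g : (ZMod 2)[X], g.map (algebraMap (ZMod 2) F) = genPoly r m S α := by
  classical
  have : CharP F 2 := charP_of_injective_algebraMap (algebraMap (ZMod 2) F).injective 2
  have hprod : genPoly r m S α =
      ∏ x ∈ (indexSet r m S).image (fun j => α ^ j), (X - C (x : F)) := by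
    rw [Finset.prod_image]
    · simp [genPoly]
    · intro i hi j hj h
      rw [Finset.mem_coe, mem_indexSet] at hi hj
      exact pow_inj_of_orderOf hα (by omega) (by omega) h
  have hmaps : ∀ x ∈ (indexSet r m S).image (fun j => α ^ j),
      x ^ 2 ∈ (indexSet r m S).image (fun j => α ^ j) := fun x hx => by
    have h := sq_mem_rootSet (r := r) (S := S) hα (x := x) (by simpa [rootSet] using hx)
    simpa [rootSet] using h
  have hinj : Set.InjOn (fun x : Fˣ => x ^ 2)
      ((indexSet r m S).image (fun j => α ^ j) : Finset Fˣ) := fun x _ y _ h => by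
    refine Units.ext (frobenius_inj F 2 ?_)
    simpa [frobenius_def, Units.ext_iff] using h
  have hfix : (genPoly r m S α).map (frobenius F 2) = genPoly r m S α := by
    rw [hprod, Polynomial.map_prod]
    refine Finset.prod_nbij (fun x => x ^ 2) hmaps hinj
      (Finset.surjOn_of_injOn_of_card_le _ hmaps hinj le_rfl) fun x _ => ?_
    simp [frobenius_def]
  have hl : genPoly r m S α ∈ lifts (algebraMap (ZMod 2) F) := by
    rw [lifts_iff_coeff_lifts]
    intro k
    have h1 := congrArg (fun p => p.coeff k) hfix
    simp only [coeff_map, frobenius_def, sq] at h1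
    -- A coefficient fixed by Frobenius is idempotent, hence 0 or 1.
    rcases IsIdempotentElem.iff_eq_zero_or_one.1 h1 with h2 | h2
    · exact ⟨0, by simp [h2]⟩
    · exact ⟨1, by simp [h2]⟩
  exact (mem_lifts _).1 hl

end Code

/-! ### Duals, extensions and distance bounds of the duadic codes. -/

section Duadic

variable {F : Type*} [Field F] [Algebra (ZMod 2) F] {r m : ℕ} {S : Finset (ZMod r)} {α : Fˣ}

theorem X_sub_one_dvd_iff {p : (ZMod 2)[X]} : X - 1 ∣ p ↔ aeval (1 : F) p = 0 := by
  rw [← C_1, dvd_iff_isRoot, IsRoot, ← map_one (algebraMap (ZMod 2) F),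
    aeval_algebraMap_apply, map_eq_zero]
  simp

theorem aeval_one_wordPoly {n : ℕ} (c : Fin n → ZMod 2) :
    aeval (1 : F) (wordPoly c) = algebraMap (ZMod 2) F (∑ i, c i) := by
  rw [aeval_wordPoly, map_sum]
  simp

theorem aeval_eq_zero_iff_mem_rootSet {g : (ZMod 2)[X]}
    (hg : g.map (algebraMap (ZMod 2) F) = genPoly r m S α) {x : Fˣ} :
    aeval (x : F) g = 0 ↔ x ∈ rootSet r m S α := by
  rw [← eval_map_algebraMap, hg, genPoly, eval_prod, Finset.prod_eq_zero_iff]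
  refine exists_congr fun j => and_congr_right fun _ => ?_
  simp [sub_eq_zero, Units.ext_iff, eq_comm]

theorem isGeneratorPolynomial_code (hα : orderOf α = 2 ^ m - 1) {g : (ZMod 2)[X]}
    (hg : g.map (algebraMap (ZMod 2) F) = genPoly r m S α) :
    IsGeneratorPolynomial (code r m S α) g := by
  have hinj := (algebraMap (ZMod 2) F).injective
  have hmon : g.Monic := monic_of_injective hinj (hg ▸ monic_genPoly)
  refine ⟨hmon, ?_, fun c => ?_⟩
  · rw [← map_dvd_map _ hinj hmon, hg, genPoly_dvd_iff hα]
    intro x ⟨j, _, hx⟩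
    have h1 : x ^ (2 ^ m - 1) = 1 := by
      rw [← hx, ← hα, ← pow_mul, mul_comm, pow_mul, pow_orderOf_eq_one, one_pow]
    have h2 : (x : F) ^ (2 ^ m - 1) = 1 := by rw [← Units.val_pow_eq_pow_val, h1, Units.val_one]
    simp [h2]
  · rw [← map_dvd_map _ hinj hmon, hg]
    rfl

theorem hasDefiningSet_code (hα : orderOf α = 2 ^ m - 1) :
    HasDefiningSet α (code r m S α) {i : ZMod (2 ^ m - 1) | α ^ i.val ∈ rootSet r m S α} := by
  obtain ⟨g, hg⟩ := exists_map_eq_genPoly (r := r) (S := S) hα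
  refine ⟨g, isGeneratorPolynomial_code hα hg, ?_⟩
  ext i
  simp only [Set.mem_ofPred_eq]
  rw [← aeval_eq_zero_iff_mem_rootSet hg, Units.val_pow_eq_pow_val]

theorem finrank_code (hα : orderOf α = 2 ^ m - 1) (hm : m ≠ 0) (hS : IsReflecting m S) :
    Module.finrank (ZMod 2) (code r m S α) = 2 ^ (m - 1) := by
  obtain ⟨g, hg⟩ := exists_map_eq_genPoly (r := r) (S := S) hα
  have hn := (odd_two_pow_sub_one hm).pos.ne'
  rw [(isGeneratorPolynomial_code hα hg).finrank_eq hn,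
    ← natDegree_map_eq_of_injective (algebraMap (ZMod 2) F).injective g, hg, natDegree_genPoly,
    hS.card_indexSet hm]
  obtain ⟨k, rfl⟩ := Nat.exists_eq_succ_of_ne_zero hm
  have : 0 < 2 ^ k := by positivity
  rw [Nat.succ_eq_add_one, pow_succ, Nat.add_sub_cancel]
  omega

theorem finrank_dualCode_code (hα : orderOf α = 2 ^ m - 1) (hm : m ≠ 0)
    (hS : IsReflecting m S) :
    Module.finrank (ZMod 2) (dualCode (code r m S α)) = 2 ^ (m - 1) - 1 := by
  rw [finrank_dualCode, finrank_code hα hm hS, Fintype.card_fin]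
  obtain ⟨k, rfl⟩ := Nat.exists_eq_succ_of_ne_zero hm
  rw [Nat.succ_eq_add_one, pow_succ, Nat.add_sub_cancel]
  omega

/-- For `c`, `e` in the code with `e` of even weight, `c(x) e(1/x)` vanishes on all units. -/
theorem aeval_mul_aeval_inv_eq_zero [Finite F] (hgen : Subgroup.zpowers α = ⊤)
    (hα : orderOf α = 2 ^ m - 1) (hS : IsReflecting m S) {c e : Fin (2 ^ m - 1) → ZMod 2}
    (hc : c ∈ code r m S α) (he : e ∈ code r m S α) (he' : ∑ i, e i = 0) (x : Fˣ) :
    aeval (x : F) (wordPoly c) * aeval ((x⁻¹ : Fˣ) : F) (wordPoly e) = 0 := by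
  rw [mem_code_iff hα] at hc he
  by_cases hx : x = 1
  · rw [hx, inv_one, Units.val_one, aeval_one_wordPoly e, he', map_zero, mul_zero]
  · by_cases hxr : x ∈ rootSet r m S α
    · rw [hc x hxr, zero_mul]
    · rw [he _ ((inv_mem_rootSet hgen hα hS hx).2 hxr), mul_zero]

/-- The multiples of `(X - 1) * g` are the even-weight codewords. They are orthogonal to the code by
the correlation at shift zero, and the dimensions agree. -/
theorem isGeneratorPolynomial_dualCode [Finite F] (hgen : Subgroup.zpowers α = ⊤)
    (hα : orderOf α = 2 ^ m - 1) (hm : m ≠ 0) (hS : IsReflecting m S) {g : (ZMod 2)[X]}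
    (hg : g.map (algebraMap (ZMod 2) F) = genPoly r m S α) :
    IsGeneratorPolynomial (dualCode (code r m S α)) ((X - 1) * g) := by
  obtain ⟨hmon, hdvd, hmem⟩ := isGeneratorPolynomial_code hα hg
  have hn := (odd_two_pow_sub_one hm).pos.ne'
  have : NeZero (2 ^ m - 1) := ⟨hn⟩
  have hX : (X - 1 : (ZMod 2)[X]).Monic := by rw [← C_1]; exact monic_X_sub_C 1
  have hcop : IsCoprime (X - 1 : (ZMod 2)[X]) g := by
    have hirr : Irreducible (X - 1 : (ZMod 2)[X]) := by rw [← C_1]; exact irreducible_X_sub_C 1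
    rw [hirr.coprime_iff_not_dvd, X_sub_one_dvd_iff (F := F), ← Units.val_one,
      aeval_eq_zero_iff_mem_rootSet hg]
    exact one_notMem_rootSet hα
  have hE : IsGeneratorPolynomial (cyclicCode (2 ^ m - 1) ((X - 1) * g)) ((X - 1) * g) :=
    ⟨hX.mul hmon, hcop.mul_dvd (by rw [X_sub_one_dvd_iff (F := F)]; simp) hdvd, fun _ => Iff.rfl⟩
  have hle : cyclicCode (2 ^ m - 1) ((X - 1) * g) ≤ dualCode (code r m S α) := by
    intro e he c hc
    have h1 : ∑ i, e i = 0 := by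
      have := (X_sub_one_dvd_iff (F := F)).1 ((dvd_mul_right _ _).trans he)
      rwa [aeval_one_wordPoly, map_eq_zero] at this
    have h2 : e ∈ code r m S α := (hmem e).2 ((dvd_mul_left _ _).trans he)
    have := sum_mul_eq_zero_of_aeval (card_units_of_generator hgen hα)
      (aeval_mul_aeval_inv_eq_zero hgen hα hS hc h2 h1)
    rw [← this]
    exact Finset.sum_congr rfl fun i _ => mul_comm _ _
  have hfin : Module.finrank (ZMod 2) (dualCode (code r m S α)) ≤
      Module.finrank (ZMod 2) (cyclicCode (2 ^ m - 1) ((X - 1) * g)) := by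
    have h1 := (isGeneratorPolynomial_code hα hg).finrank_eq hn
    have h2 : (X - 1 : (ZMod 2)[X]).natDegree = 1 := by rw [← C_1]; exact natDegree_X_sub_C 1
    rw [hE.finrank_eq hn, hX.natDegree_mul hmon, h2, finrank_dualCode_code hα hm hS]
    rw [finrank_code hα hm hS] at h1
    omega
  rw [← Submodule.eq_of_le_of_finrank_le hle hfin]
  exact hE

theorem hasDefiningSet_dualCode [Finite F] (hgen : Subgroup.zpowers α = ⊤)
    (hα : orderOf α = 2 ^ m - 1) (hm : m ≠ 0) (hS : IsReflecting m S) :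
    HasDefiningSet α (dualCode (code r m S α))
      ({0} ∪ {i : ZMod (2 ^ m - 1) | α ^ i.val ∈ rootSet r m S α}) := by
  obtain ⟨g, hg⟩ := exists_map_eq_genPoly (r := r) (S := S) hα
  refine ⟨_, isGeneratorPolynomial_dualCode hgen hα hm hS hg, ?_⟩
  have : NeZero (2 ^ m - 1) := ⟨(odd_two_pow_sub_one hm).pos.ne'⟩
  ext i
  simp only [Set.mem_union, Set.mem_singleton_iff, Set.mem_ofPred_eq, map_mul, mul_eq_zero]
  refine or_congr ?_ ?_
  · rw [map_sub, aeval_X, map_one, sub_eq_zero, ← Units.val_pow_eq_pow_val, Units.val_eq_one,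
      ← ZMod.val_eq_zero]
    refine ⟨fun h => by rw [h, pow_zero], fun h => ?_⟩
    exact pow_inj_of_orderOf hα i.val_lt (NeZero.pos _) (by rw [h, pow_zero])
  · rw [← aeval_eq_zero_iff_mem_rootSet hg, Units.val_pow_eq_pow_val]

theorem equivalentVia_rev_code [NeZero r] [Finite F] (hgen : Subgroup.zpowers α = ⊤)
    (hα : orderOf α = 2 ^ m - 1) (hS : IsReflecting m S) :
    EquivalentVia Fin.revPerm (code r m S α) (code r m Sᶜ α) := by
  intro c
  rw [mem_code_iff hα, mem_code_iff hα]
  constructor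
  · intro h x hx
    rw [aeval_wordPoly_comp_rev, h, mul_zero]
    rw [← inv_mem_rootSet_compl hgen hα hS, inv_inv]
    exact hx
  · intro h x hx
    have h1 := h x⁻¹ ((inv_mem_rootSet_compl hgen hα hS x).2 hx)
    rw [aeval_wordPoly_comp_rev, inv_inv] at h1
    exact (mul_eq_zero.1 h1).resolve_left (pow_ne_zero _ (Units.ne_zero _))

/-- The polynomial of the all-one word is `(x ^ n - 1) / (x - 1)`, which vanishes at every `n`-th
root of unity except 1. -/
theorem one_mem_code (hα : orderOf α = 2 ^ m - 1) : (1 : Fin (2 ^ m - 1) → ZMod 2) ∈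
    code r m S α := by
  rw [mem_code_iff hα]
  intro x hx
  have h1 : (x : F) ^ (2 ^ m - 1) = 1 := by
    obtain ⟨j, _, rfl⟩ := hx
    rw [← Units.val_pow_eq_pow_val, ← hα, ← pow_mul, mul_comm, pow_mul, pow_orderOf_eq_one,
      one_pow, Units.val_one]
  have hx1 : (x : F) - 1 ≠ 0 := by
    rw [sub_ne_zero, ne_eq, Units.val_eq_one]
    rintro rfl
    exact one_notMem_rootSet hα hx
  refine (mul_eq_zero.1 ?_).resolve_right hx1
  rw [aeval_wordPoly]
  simp only [Pi.one_apply, map_one, one_mul]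
  rw [Fin.sum_univ_eq_sum_range (fun i => (x : F) ^ i), geom_sum_mul, h1, sub_self]

theorem hammingNorm_eq_castSucc {n : ℕ} (x : Fin (n + 1) → ZMod 2) :
    hammingNorm x = hammingNorm (fun i : Fin n => x i.castSucc) +
      if x (Fin.last n) ≠ 0 then 1 else 0 := by
  simp only [hammingNorm, Finset.card_filter, Fin.sum_univ_castSucc]

theorem isDoublyEven_extendedCode [Finite F] (hgen : Subgroup.zpowers α = ⊤)
    (hα : orderOf α = 2 ^ m - 1) (hm : 2 ≤ m) (hS : IsReflecting m S) :
    IsDoublyEven (extendedCode (code r m S α)) := by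
  have hodd := odd_two_pow_sub_one (m := m) (by omega)
  have : NeZero (2 ^ m - 1) := ⟨hodd.pos.ne'⟩
  have heven : ∀ c ∈ code r m S α, ∑ i, c i = 0 → 4 ∣ hammingNorm c := fun c hc h0 =>
    four_dvd_hammingNorm_of_aeval (card_units_of_generator hgen hα) hodd
      (aeval_mul_aeval_inv_eq_zero hgen hα hS hc hc h0)
  rintro x ⟨hc, hx⟩
  rw [hammingNorm_eq_castSucc]
  rw [Fin.sum_univ_castSucc] at hx
  set c : Fin (2 ^ m - 1) → ZMod 2 := fun i => x i.castSucc with hcdef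
  rcases zmod_two_cases (x (Fin.last _)) with hl | hl <;> rw [hl] at hx ⊢
  · rw [add_zero] at hx
    simpa using heven c hc hx
  -- For odd weight, the complement `c + 1` is an even-weight codeword of weight `2 ^ m - 1 -
  -- hammingNorm c`. As 4 divides both this and `2 ^ m`, it divides `hammingNorm c + 1`.
  · have h1 : ∑ i, (c + 1) i = 0 := by
      simp only [Pi.add_apply, Pi.one_apply, Finset.sum_add_distrib, Finset.sum_const,
        Finset.card_univ, Fintype.card_fin, nsmul_eq_mul, mul_one]
      rw [(ZMod.natCast_eq_one_iff_odd).2 hodd]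
      exact hx
    have h2 := heven _ ((code r m S α).add_mem hc (one_mem_code hα)) h1
    have h3 := hammingNorm_add c 1
    have h4 : hammingNorm (1 : Fin (2 ^ m - 1) → ZMod 2) = 2 ^ m - 1 := by simp [hammingNorm]
    have h5 : (4 : ℕ) ∣ 2 ^ m := pow_dvd_pow 2 hm
    rw [mul_one, h4] at h3
    have h6 : 0 < 2 ^ m := by positivity
    simp only [ne_eq, one_ne_zero, not_false_eq_true, if_true]
    omega

theorem isSelfDual_extendedCode [Finite F] (hgen : Subgroup.zpowers α = ⊤)
    (hα : orderOf α = 2 ^ m - 1) (hm : 2 ≤ m) (hS : IsReflecting m S) :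
    IsSelfDual (extendedCode (code r m S α)) := by
  refine (isDoublyEven_extendedCode hgen hα hm hS).isSelfDual ?_
  rw [finrank_extendedCode, finrank_code hα (by omega) hS, Fintype.card_fin, ← pow_succ',
    Nat.sub_add_cancel (by omega : 1 ≤ m), Nat.sub_add_cancel Nat.one_le_two_pow]

/-- The powers `β ^ t` with `1 ≤ t ≤ 2 ^ h` of `β = α ^ (2 ^ h - 1)` have exponents of weight
`h`. -/
theorem two_pow_lt_hammingNorm {h : ℕ} (h0 : h ≠ 0) (hm : m = 2 * h + 1)
    (hα : orderOf α = 2 ^ m - 1) (hS : (h : ZMod r) ∈ S) {c : Fin (2 ^ m - 1) → ZMod 2}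
    (hc : c ∈ code r m S α) (hc0 : c ≠ 0) : 2 ^ h < hammingNorm c := by
  -- The gcd is `2 ^ gcd(m, h) - 1 = 1` because `m = 2 * h + 1`; thus the power of `α` used below is
  -- again a primitive `n`-th root of unity.
  have hcop : (orderOf α).Coprime (2 ^ h - 1) := by
    rw [hα, Nat.Coprime, Nat.pow_sub_one_gcd_pow_sub_one, hm]
    simp
  have hord := hcop.orderOf_pow
  rw [hα] at hord
  rw [mem_code_iff hα] at hc
  have hh : 2 ≤ 2 ^ h := Nat.pow_le_pow_right two_pos (Nat.one_le_iff_ne_zero.2 h0)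
  refine lt_hammingNorm_of_consecutive_zeros (β := ((α ^ (2 ^ h - 1) : Fˣ) : F)) (Units.ne_zero _)
    ?_ hc0 fun t ht => ?_
  · intro i hi j hj hij
    simp only [← Units.val_pow_eq_pow_val] at hij
    exact pow_inj_of_orderOf hord hi hj (Units.ext hij)
  · rw [← Units.val_pow_eq_pow_val]
    refine hc _ ⟨(t + 1) * (2 ^ h - 1), mem_indexSet.2 ⟨⟨?_, ?_⟩, ?_⟩, ?_⟩
    · exact Nat.mul_pos (Nat.succ_pos _) (by omega)
    · have h1 : (t + 1) * (2 ^ h - 1) ≤ 2 ^ h * (2 ^ h - 1) := Nat.mul_le_mul_right _ ht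
      have h2 : 2 ^ m = 2 * (2 ^ h * 2 ^ h) := by rw [hm]; ring
      have h3 : 2 ^ h * (2 ^ h - 1) = 2 ^ h * 2 ^ h - 2 ^ h := by rw [Nat.mul_sub, mul_one]
      omega
    · rwa [binaryWeight_succ_mul_two_pow_sub_one ht]
    · rw [← pow_mul, mul_comm]

/-- The weight exceeds `2 ^ h` by the BCH bound. It and `2 ^ h` are multiples of 4, the latter since
`2 ≤ h`. -/
theorem two_pow_add_four_le_minDist_extendedCode [Finite F] (hgen : Subgroup.zpowers α = ⊤)
    {h : ℕ} (h2 : 2 ≤ h) (hm : m = 2 * h + 1) (hα : orderOf α = 2 ^ m - 1)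
    (hS : IsReflecting m S) (hh : (h : ZMod r) ∈ S) :
    ∀ x ∈ extendedCode (code r m S α), x ≠ 0 → 2 ^ h + 4 ≤ hammingNorm x := by
  intro x hx hx0
  have h4 := isDoublyEven_extendedCode hgen hα (by omega) hS x hx
  have hc0 : (fun i : Fin (2 ^ m - 1) => x i.castSucc) ≠ 0 := by
    intro hc
    have h1 : ∀ i : Fin (2 ^ m - 1), x i.castSucc = 0 := fun i => congrFun hc i
    have h3 := hx.2
    rw [Fin.sum_univ_castSucc] at h3
    refine hx0 (funext fun i => Fin.lastCases ?_ (fun i => h1 i) i)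
    simpa [h1] using h3
  have h5 := two_pow_lt_hammingNorm (by omega) hm hα hh hx.1 hc0
  have h6 := hammingNorm_eq_castSucc x
  have h7 : (4 : ℕ) ∣ 2 ^ h := pow_dvd_pow 2 h2
  omega

/-- The minimum distance bounds, for the code, its dual and the extended code. -/
theorem minDist_bounds [Finite F] (hgen : Subgroup.zpowers α = ⊤)
    {h : ℕ} (h2 : 2 ≤ h) (hm : m = 2 * h + 1) (hα : orderOf α = 2 ^ m - 1)
    (hS : IsReflecting m S) (hh : (h : ZMod r) ∈ S) :
    2 ^ h + 3 ≤ minDist (code r m S α) ∧ 2 ^ h + 4 ≤ minDist (dualCode (code r m S α)) ∧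
      2 ^ h + 4 ≤ minDist (extendedCode (code r m S α)) := by
  have hext := two_pow_add_four_le_minDist_extendedCode hgen h2 hm hα hS hh
  have hm0 : m ≠ 0 := by omega
  have hpos : 2 ≤ 2 ^ (m - 1) := Nat.pow_le_pow_right two_pos (by omega : 1 ≤ m - 1)
  -- The parity bit `a` adds at most 1 to the weight, which costs 1 for the code. Words of the dual
  -- have even weight, so there `a = 0` and nothing is lost.
  have hsnoc : ∀ c ∈ code r m S α, c ≠ 0 → ∀ a, ∑ i, c i + a = 0 →
      2 ^ h + 4 ≤ hammingNorm c + if a ≠ 0 then 1 else 0 := by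
    intro c hc hc0 a ha
    have h1 := hext (Fin.snoc (α := fun _ => ZMod 2) c a) ⟨by simpa using hc, by
      rw [Fin.sum_univ_castSucc]; simpa using ha⟩ fun h0 => hc0 (funext fun i => by
        simpa using congrFun h0 i.castSucc)
    rw [hammingNorm_eq_castSucc] at h1
    simpa using h1
  refine ⟨?_, ?_, ?_⟩
  · refine le_minDist (by rw [finrank_code hα hm0 hS]; omega) fun c hc hc0 => ?_
    have h1 := hsnoc c hc hc0 (∑ i, c i) (CharTwo.add_self_eq_zero _)
    split_ifs at h1 <;> omega
  · refine le_minDist (by rw [finrank_dualCode_code hα hm0 hS]; omega) fun c hc hc0 => ?_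
    obtain ⟨g, hg⟩ := exists_map_eq_genPoly (r := r) (S := S) hα
    have hc' := (isGeneratorPolynomial_dualCode hgen hα hm0 hS hg).2.2 c |>.1 hc
    have h3 : ∑ i, c i = 0 := by
      simpa using hc 1 (one_mem_code hα)
    have h4 := hsnoc c (((isGeneratorPolynomial_code hα hg).2.2 c).2
      ((dvd_mul_left _ _).trans hc')) hc0 0 (by rw [h3, add_zero])
    simpa using h4
  · exact le_minDist (by rw [finrank_extendedCode, finrank_code hα hm0 hS]; omega) hext

end Duadic

end BinaryDuadic

/-! ### The six sets modulo 8. -/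

theorem theorem13 {F : Type*} [Field F] [Algebra (ZMod 2) F] (m : ℕ) (hm : m % 8 = 7)
    (hF : Nat.card F = 2 ^ m) (α : Fˣ) (hα : Subgroup.zpowers α = ⊤)
    (S : Finset (ZMod 8))
    (hS : S = {0, 1, 2, 3} ∨ S = {0, 1, 3, 5} ∨ S = {0, 1, 2, 4} ∨ S = {0, 4, 5, 6} ∨
      S = {0, 2, 3, 6} ∨ S = {0, 3, 5, 6}) :
    -- the products `g_{[8,m,S]}` and `g_{[8,m,S']}` lie in `𝔽₂[x]`, and the codes are the binary
    -- cyclic codes that they generate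
    (∃ g : (ZMod 2)[X], g.map (algebraMap (ZMod 2) F) = genPoly 8 m S α ∧
      IsGeneratorPolynomial (code 8 m S α) g) ∧
    (∃ g : (ZMod 2)[X], g.map (algebraMap (ZMod 2) F) = genPoly 8 m Sᶜ α ∧
      IsGeneratorPolynomial (code 8 m Sᶜ α) g) ∧
    -- duadic pairs
    IsOddLikeDuadicPair α (code 8 m S α) (code 8 m Sᶜ α) ∧
    IsEvenLikeDuadicPair α (dualCode (code 8 m S α)) (dualCode (code 8 m Sᶜ α)) ∧
    -- parameters: `d`, `d'`, `e` are the minimum distances of the codes, of the dual codes and of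
    -- the extended codes
    (∃ d d' e : ℕ,
      HasParameters (code 8 m S α) (2 ^ m - 1) (2 ^ (m - 1)) d ∧
      HasParameters (code 8 m Sᶜ α) (2 ^ m - 1) (2 ^ (m - 1)) d ∧
      HasParameters (dualCode (code 8 m S α)) (2 ^ m - 1) (2 ^ (m - 1) - 1) d' ∧
      HasParameters (dualCode (code 8 m Sᶜ α)) (2 ^ m - 1) (2 ^ (m - 1) - 1) d' ∧
      HasParameters (extendedCode (code 8 m S α)) (2 ^ m) (2 ^ (m - 1)) e ∧
      HasParameters (extendedCode (code 8 m Sᶜ α)) (2 ^ m) (2 ^ (m - 1)) e ∧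
      (S = {0, 1, 2, 3} ∨ S = {0, 1, 3, 5} →
        (m % 16 = 7 → 2 ^ ((m - 1) / 2) + 1 ≤ d ∧ 2 ^ ((m - 1) / 2) + 2 ≤ d') ∧
        (m % 16 = 15 → 2 ^ ((m - 1) / 2) + 3 ≤ d ∧ 2 ^ ((m - 1) / 2) + 4 ≤ d')) ∧
      (S = {0, 1, 2, 4} → 2 ^ ((m - 1) / 2) + 3 ≤ d ∧ 2 ^ ((m - 1) / 2) + 4 ≤ d') ∧
      (S = {0, 4, 5, 6} → 2 ^ ((m - 1) / 2) + 1 ≤ d ∧ 2 ^ ((m - 1) / 2) + 2 ≤ d') ∧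
      (S = {0, 2, 3, 6} ∨ S = {0, 3, 5, 6} →
        (m % 16 = 7 → 2 ^ ((m - 1) / 2) + 3 ≤ d ∧ 2 ^ ((m - 1) / 2) + 4 ≤ d') ∧
        (m % 16 = 15 → 2 ^ ((m - 1) / 2) + 1 ≤ d ∧ 2 ^ ((m - 1) / 2) + 2 ≤ d')) ∧
      2 ^ ((m - 1) / 2) + 4 ≤ e) ∧
    -- the extended codes
    IsSelfDual (extendedCode (code 8 m S α)) ∧ IsDoublyEven (extendedCode (code 8 m S α)) ∧
    IsSelfDual (extendedCode (code 8 m Sᶜ α)) ∧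
    IsDoublyEven (extendedCode (code 8 m Sᶜ α)) := by
  have : Finite F := Nat.finite_of_card_ne_zero (by rw [hF]; positivity)
  have hα' : orderOf α = 2 ^ m - 1 := by
    rw [orderOf_eq_card_of_zpowers_eq_top hα, Nat.card_units, hF]
  obtain ⟨h, rfl⟩ : ∃ h, m = 2 * h + 1 := ⟨m / 2, by omega⟩
  have h2 : 2 ≤ h := by omega
  have hm0 : 2 * h + 1 ≠ 0 := by omega
  have hcast : ((2 * h + 1 : ℕ) : ZMod 8) = 7 := by
    rw [← ZMod.natCast_mod, hm]
    rfl
  have hR : IsReflecting (2 * h + 1) S := by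
    unfold IsReflecting
    rw [hcast]
    rcases hS with rfl | rfl | rfl | rfl | rfl | rfl <;> decide
  have hR' := hR.compl
  have hequiv := equivalentVia_rev_code hα hα' hR
  have hd : 2 ^ h + 3 ≤ minDist (code 8 (2 * h + 1) S α) ∧
      2 ^ h + 4 ≤ minDist (dualCode (code 8 (2 * h + 1) S α)) ∧
      2 ^ h + 4 ≤ minDist (extendedCode (code 8 (2 * h + 1) S α)) := by
    -- The BCH run consists of zeros of weight `h`, which belong to the code of `S` or to that of
    -- its complement; in the second case the bounds are carried over by reversal.
    by_cases hh : (h : ZMod 8) ∈ S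
    · exact minDist_bounds hα h2 rfl hα' hR hh
    · rw [hequiv.minDist_eq, hequiv.dualCode.minDist_eq, hequiv.extendedCode.minDist_eq]
      exact minDist_bounds hα h2 rfl hα' hR' (Finset.mem_compl.2 hh)
  have hlen : 2 ^ (2 * h + 1) - 1 + 1 = 2 ^ (2 * h + 1) := Nat.sub_add_cancel Nat.one_le_two_pow
  have hhalf : (2 * h + 1 - 1) / 2 = h := by omega
  obtain ⟨g, hg⟩ := exists_map_eq_genPoly (r := 8) (S := S) hα'
  obtain ⟨g', hg'⟩ := exists_map_eq_genPoly (r := 8) (S := Sᶜ) hα'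
  refine ⟨⟨g, hg, isGeneratorPolynomial_code hα' hg⟩, ⟨g', hg', isGeneratorPolynomial_code hα' hg'⟩,
    ⟨_, _, isSplitting_rootSet hα hα' hm0 hR, hasDefiningSet_code hα', hasDefiningSet_code hα'⟩,
    ⟨_, _, isSplitting_rootSet hα hα' hm0 hR, hasDefiningSet_dualCode hα hα' hm0 hR,
      hasDefiningSet_dualCode hα hα' hm0 hR'⟩,
    ⟨minDist (code 8 (2 * h + 1) S α), minDist (dualCode (code 8 (2 * h + 1) S α)),
      minDist (extendedCode (code 8 (2 * h + 1) S α)), ⟨Fintype.card_fin _, ?_, rfl⟩,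
      ⟨Fintype.card_fin _, ?_, hequiv.minDist_eq.symm⟩, ⟨Fintype.card_fin _, ?_, rfl⟩,
      ⟨Fintype.card_fin _, ?_, hequiv.dualCode.minDist_eq.symm⟩,
      ⟨(Fintype.card_fin _).trans hlen, ?_, rfl⟩,
      ⟨(Fintype.card_fin _).trans hlen, ?_, hequiv.extendedCode.minDist_eq.symm⟩, ?_⟩,
    isSelfDual_extendedCode hα hα' (by omega) hR, isDoublyEven_extendedCode hα hα' (by omega) hR,
    isSelfDual_extendedCode hα hα' (by omega) hR', isDoublyEven_extendedCode hα hα' (by omega) hR'⟩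
  · exact finrank_code hα' hm0 hR
  · exact finrank_code hα' hm0 hR'
  · exact finrank_dualCode_code hα' hm0 hR
  · exact finrank_dualCode_code hα' hm0 hR'
  · rw [finrank_extendedCode, finrank_code hα' hm0 hR]
  · rw [finrank_extendedCode, finrank_code hα' hm0 hR']
  -- Every bound required for `d` and `d'` is at most the uniform one in `hd`, whatever `S` and `m %
  -- 16` are.
  · rw [hhalf]
    refine ⟨fun _ => ⟨fun _ => ⟨?_, ?_⟩, fun _ => ⟨?_, ?_⟩⟩, fun _ => ⟨?_, ?_⟩, fun _ => ⟨?_, ?_⟩,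
      fun _ => ⟨fun _ => ⟨?_, ?_⟩, fun _ => ⟨?_, ?_⟩⟩, hd.2.2⟩ <;> omega
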